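/- Let $d \ge 0$ and $k \ge d+2$ be integers, and let $V=\mathbb{R}^d$ be equipped with a non-degenerate symmetric bilinear form $\langle\cdot,\cdot\rangle$. For weights $\pi_1,\dots,\pi_k>0$ with $\sum_{i=1}^k \pi_i=1$ and means $\mu_1,\dots,\mu_k\in V$ put \[ \rho_{\pi,\mu}(x)=\sum_{i=1}^k \pi_i\,\frac{\sqrt{|\det G|}}{\sqrt{(2\pi)^d}}\; e^{-\frac12\langle x-\mu_i,\,x-\mu_i\rangle}, \] where $G$ is the Gram matrix of $\langle\cdot,\cdot\rangle$ in the standard basis (and the $\pi$ in $(2\pi)^d$ is the number $\pi$). When $\rho_{\pi,\mu}$ is a probability density, let $r_{\pi,\mu}$ denote the probability distribution of $\Delta=\langle x_1-x_2,\,x_1-x_2\rangle$, where $x_1,x_2$ are independent random variables with density $\rho_{\pi,\mu}$. Then there is a non-zero polynomial $f$ in the $kd$ coordinates of the $k$ means, depending only on $d$, $k$ and the form, such that the following holds for all means $\mu=(\mu_1,\dots,\mu_k)$ that are generic in the sense that $f(\mu)\neq 0$, and for all weights $\pi$ as above for which $\rho_{\pi,\mu}$ is a probability density. Let $\bar\pi,\bar\mu$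 be any weights (positive, with sum $1$) and any $k$ means (generic or not) such that $\rho_{\bar\pi,\bar\mu}$ is a probability density and $r_{\bar\pi,\bar\mu}=r_{\pi,\mu}$. Then there are $g\in O(V)$, i.e. a linear automorphism of $V$ with $\langle gx,gy\rangle=\langle x,y\rangle$ for all $x,y\in V$, and a vector $v\in V$ such that $\rho_{\bar\pi,\bar\mu}(x)=\rho_{\pi,\mu}(gx+v)$ for all $x\in V$. That is, $\rho$ is determined by the distribution of $\Delta$ up to the isometries of $(V,\langle\cdot,\cdot\rangle)$, which are the elements of $O(V)$ composed with translations. -/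

import Mathlib

noncomputable section

/-- The density on `V = ℝ^d` of the mixture, with weights `w` and means `μ`, of the `k` Gaussians
attached to the bilinear form `B`:
`ρ(x) = ∑ i, w i * √|det B| / √((2π)^d) * exp (-B(x - μ i, x - μ i) / 2)`.
Here `det B` is the Gram determinant of `B` in the standard basis; the factor `√|det B|` is the
normalisation of the Gaussian, and equals `1` for the Euclidean inner product. -/
def mixtureDensity {d k : ℕ} (B : LinearMap.BilinForm ℝ (Fin d → ℝ)) (w : Fin k → ℝ)
    (μ : Fin k → Fin d → ℝ) (x : Fin d → ℝ) : ℝ :=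
  ∑ i, w i * (√|(LinearMap.BilinForm.toMatrix' B).det| / √((2 * Real.pi) ^ d)) *
    Real.exp (-(1 / 2) * B (x - μ i) (x - μ i))

/-- The measure on `ℝ^d` whose density with respect to Lebesgue measure is `mixtureDensity`. -/
def mixtureMeasure {d k : ℕ} (B : LinearMap.BilinForm ℝ (Fin d → ℝ)) (w : Fin k → ℝ)
    (μ : Fin k → Fin d → ℝ) : MeasureTheory.Measure (Fin d → ℝ) :=
  MeasureTheory.volume.withDensity fun x => ENNReal.ofReal (mixtureDensity B w μ x)

/-- The law of `Δ = B(x₁ - x₂, x₁ - x₂)`, where `x₁` and `x₂` are independent with law `P`. -/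
def deltaLaw {d : ℕ} (B : LinearMap.BilinForm ℝ (Fin d → ℝ))
    (P : MeasureTheory.Measure (Fin d → ℝ)) : MeasureTheory.Measure ℝ :=
  (P.prod P).map fun x => B (x.1 - x.2) (x.1 - x.2)

end

/-! The Laplace transform of the law of Δ is a sum over ordered pairs of components. Once a Gaussian
factor independent of weights and means is cancelled, it reads ∑ w_p w_q exp(-t D_pq), with D_pq =
B(μ_p - μ_q, μ_p - μ_q) and 0 < t < 1/4. Independence of exponentials then recovers, for each δ, the
total weight of the pairs with D_pq = δ (`sum_mul_exp_eq_of_deltaLaw_eq`,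
`sum_filter_eq_of_sum_mul_exp_eq`). For generic means the D_pq are distinct and non-zero, so the
other mixture has squared distances D ∘ σ for a permutation σ of the unordered pairs.

The core is that generically σ comes from a permutation of the points. Points in dimension d have a
Gram matrix of rank at most d. If permuting by σ breaks this bound for one configuration, it does so
off the zero set of a polynomial, and σ cannot occur for generic means. If σ respects the bound for
all configurations, a perturbation argument lowers d to 1, where configurations with coordinates 0
and 1 show that σ permutes the stars of the complete graph, hence is a relabeling
(`exists_relabeling_of_rank_le`). The required f is a product of finitely many such polynomials.

After relabeling, equal squared distances give an isometry, and the products w_p w_q determine the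
weights, as there are at least three. All this needs B positive definite; otherwise no mixture is a
probability density. -/

/-- If the rank of `A + t • S` is at most that of `A` for all `t > 0`, then `S` maps the kernel of
`A` into the range of `A`. -/
theorem Matrix.mulVec_mem_range_of_rank_add_smul_le {n : Type*} [Fintype n] [DecidableEq n]
    (A S : Matrix n n ℝ) (h : ∀ t : ℝ, 0 < t → (A + t • S).rank ≤ A.rank) (u : n → ℝ)
    (hu : A.mulVec u = 0) : S.mulVec u ∈ LinearMap.range A.mulVecLin := by
  by_contra hS
  let b := Module.finBasis ℝ (LinearMap.range A.mulVecLin)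
  choose v hv using fun i => (b i).2
  -- For t > 0 all these vectors lie in the range of A + tS, the first because (A + tS)(t⁻¹u) = Su.
  -- At t = 0 they are a basis of the range of A and a vector outside it. Independence is an open
  -- condition, so it persists for small t and makes the rank of A + tS too large.
  let F : ℝ → Fin (Module.finrank ℝ (LinearMap.range A.mulVecLin) + 1) → n → ℝ := fun t =>
    Fin.cons (S.mulVec u) (fun i => (A + t • S).mulVec (v i))
  have hF : Continuous F := by
    refine continuous_pi fun i => ?_
    refine Fin.cases ?_ (fun i => ?_) i
    · simpa [F] using continuous_const
    · simp only [F, Fin.cons_succ, Matrix.add_mulVec, Matrix.smul_mulVec]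
      fun_prop
  have h0 : LinearIndependent ℝ (F 0) := by
    have hb : (fun i => (A + (0 : ℝ) • S).mulVec (v i)) = fun i => (b i : n → ℝ) := by
      funext i
      simpa using hv i
    simp only [F]
    rw [hb]
    refine LinearIndependent.finCons ?_ ?_
    · exact b.linearIndependent.map' (Submodule.subtype _) (Submodule.ker_subtype _)
    · intro hmem
      refine hS ((Submodule.span_le.2 ?_) hmem)
      rintro _ ⟨i, rfl⟩
      exact (b i).2
  have hev := hF.continuousAt.eventually (isOpen_setOfPred_linearIndependent.eventually_mem h0)
  obtain ⟨t, hli, ht⟩ := ((hev.filter_mono nhdsWithin_le_nhds).and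
    (self_mem_nhdsWithin : Set.Ioi (0 : ℝ) ∈ nhdsWithin 0 (Set.Ioi 0))).exists
  have ht' : (0 : ℝ) < t := ht
  have hmem : ∀ i, F t i ∈ LinearMap.range (A + t • S).mulVecLin := by
    intro i
    refine Fin.cases ?_ (fun i => ?_) i
    · refine ⟨t⁻¹ • u, ?_⟩
      simp [F, Matrix.add_mulVec, Matrix.smul_mulVec, hu, smul_smul, ht'.ne']
    · exact ⟨v i, by simp only [F, Fin.cons_succ, Matrix.mulVecLin_apply]⟩
  have hle : Submodule.span ℝ (Set.range (F t)) ≤ LinearMap.range (A + t • S).mulVecLin :=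
    Submodule.span_le.2 (by rintro _ ⟨i, rfl⟩; exact hmem i)
  have hfr := Submodule.finrank_mono hle
  rw [finrank_span_eq_card (show LinearIndependent ℝ (F t) from hli), Fintype.card_fin] at hfr
  have := h t ht'
  unfold Matrix.rank at this
  omega

/-! ### Gram matrices of squared distances, and lowering the dimension -/

section SquaredDistances

/-- The squared distances between the points with coordinates `y`, on a line. -/
noncomputable def lineSqDist {k : ℕ} (y : Fin k → ℝ) : Sym2 (Fin k) → ℝ :=
  Sym2.lift ⟨fun p q => (y p - y q) ^ 2, fun p q => by ring⟩

@[simp]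
theorem lineSqDist_mk {k : ℕ} (y : Fin k → ℝ) (p q : Fin k) :
    lineSqDist y s(p, q) = (y p - y q) ^ 2 := rfl

/-- The Gram matrix, with respect to the point `0`, attached to squared distances `D`. -/
noncomputable def gramMatrix (n : ℕ) : (Sym2 (Fin (n + 1)) → ℝ) →ₗ[ℝ] Matrix (Fin n) (Fin n) ℝ where
  toFun D := Matrix.of fun i j =>
    (D s(0, i.succ) + D s(0, j.succ) - D s(i.succ, j.succ)) / 2
  map_add' D E := by ext i j; simp; ring
  map_smul' c D := by ext i j; simp; ring

theorem gramMatrix_apply {n : ℕ} (D : Sym2 (Fin (n + 1)) → ℝ) (i j : Fin n) :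
    gramMatrix n D i j = (D s(0, i.succ) + D s(0, j.succ) - D s(i.succ, j.succ)) / 2 := rfl

theorem gramMatrix_transpose {n : ℕ} (D : Sym2 (Fin (n + 1)) → ℝ) :
    (gramMatrix n D).transpose = gramMatrix n D := by
  ext i j
  simp only [Matrix.transpose_apply, gramMatrix_apply]
  rw [Sym2.eq_swap (a := j.succ)]
  ring

/-- The Gram matrix factors as X Xᵀ, where X has one column per coordinate. -/
theorem rank_gramMatrix_sum_lineSqDist_le {n m : ℕ} (x : Fin m → Fin (n + 1) → ℝ) :
    (gramMatrix n (∑ a, lineSqDist (x a))).rank ≤ m := by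
  have : gramMatrix n (∑ a, lineSqDist (x a)) =
      Matrix.of (fun (i : Fin n) a => x a i.succ - x a 0) *
        (Matrix.of (fun (i : Fin n) a => x a i.succ - x a 0)).transpose := by
    rw [map_sum]
    ext i j
    simp only [Matrix.sum_apply, gramMatrix_apply, lineSqDist_mk, Matrix.mul_apply,
      Matrix.transpose_apply, Matrix.of_apply]
    exact Finset.sum_congr rfl fun a _ => by ring
  rw [this]
  exact (Matrix.rank_mul_le_left _ _).trans (Matrix.rank_le_width _)

/-- Functions on the pairs which vanish on the diagonal are combinations of squared distances
of configurations on a line. -/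
theorem mem_span_range_lineSqDist {k : ℕ} (D : Sym2 (Fin k) → ℝ) (hD : ∀ e, e.IsDiag → D e = 0) :
    D ∈ Submodule.span ℝ (Set.range (lineSqDist (k := k))) := by
  rw [pi_eq_sum_univ' D]
  refine Submodule.sum_mem _ fun e _ => ?_
  by_cases he : e.IsDiag
  · simp [hD e he]
  refine Submodule.smul_mem _ _ ?_
  induction e using Sym2.inductionOn with
  | _ i j =>
    rw [Sym2.mk_isDiag_iff] at he
    have hs : (Pi.single s(i, j) 1 : Sym2 (Fin k) → ℝ) = (1 / 2 : ℝ) •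
        (lineSqDist (Pi.single i 1) + lineSqDist (Pi.single j 1)
          - lineSqDist (Pi.single i 1 + Pi.single j 1)) := by
      funext e
      induction e using Sym2.inductionOn with
      | _ p q =>
        simp only [Pi.smul_apply, Pi.add_apply, Pi.sub_apply, lineSqDist_mk, Pi.single_apply,
          smul_eq_mul, Sym2.eq_iff]
        by_cases hpi : p = i <;> by_cases hpj : p = j <;> by_cases hqi : q = i <;>
          by_cases hqj : q = j <;> simp_all [eq_comm] <;> norm_num
    rw [hs]
    refine Submodule.smul_mem _ _ (Submodule.sub_mem _ (Submodule.add_mem _ ?_ ?_) ?_) <;>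
      exact Submodule.subset_span ⟨_, rfl⟩

/-- These are the squared distances between the origin and the standard basis vectors. -/
theorem gramMatrix_simplex (n : ℕ) :
    gramMatrix n (fun e => if e.IsDiag then 0 else if 0 ∈ e then 1 else 2) = 1 := by
  ext i j
  simp only [gramMatrix_apply, Sym2.mk_isDiag_iff, Sym2.mem_iff, Matrix.one_apply,
    (Fin.succ_ne_zero _).symm, Fin.succ_inj]
  by_cases h : i = j <;> (simp [h]; try norm_num)

/-- If permuting the squared distances of all configurations of points in dimension `m + 1` leads
to Gram matrices of rank at most `m + 1`, then the same holds with `m` in place of `m + 1`. -/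
theorem rank_gramMatrix_comp_perm_descent {n m : ℕ} (hm : m + 1 < n)
    (σ : Equiv.Perm (Sym2 (Fin (n + 1)))) (hσ : ∀ e, (σ e).IsDiag ↔ e.IsDiag)
    (H : ∀ x : Fin (m + 1) → Fin (n + 1) → ℝ,
      (gramMatrix n ((∑ a, lineSqDist (x a)) ∘ σ)).rank ≤ m + 1)
    (x : Fin m → Fin (n + 1) → ℝ) : (gramMatrix n ((∑ a, lineSqDist (x a)) ∘ σ)).rank ≤ m := by
  by_contra hlt
  set A := gramMatrix n ((∑ a, lineSqDist (x a)) ∘ σ) with hA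
  have key : ∀ (y : Fin (n + 1) → ℝ) (t : ℝ), 0 ≤ t →
      (A + t • gramMatrix n (lineSqDist y ∘ σ)).rank ≤ m + 1 := by
    intro y t ht
    -- Adjoining √t • y as one more coordinate adds t times its squared distances.
    refine le_of_eq_of_le ?_ (H (Fin.cons (√t • y) x))
    rw [Fin.sum_univ_succ, hA, ← map_smul, ← map_add]
    congr 2
    funext e
    simp only [Fin.cons_zero, Fin.cons_succ, Pi.add_apply, Function.comp_apply, Pi.smul_apply]
    induction σ e using Sym2.inductionOn with
    | _ p q =>
      simp only [lineSqDist_mk, Pi.smul_apply, smul_eq_mul, ← mul_sub, mul_pow, Real.sq_sqrt ht]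
      ring
  have hrk : A.rank = m + 1 := by
    have := key 0 0 le_rfl
    rw [zero_smul, add_zero] at this
    omega
  -- The condition on S is linear, so it passes from squared distances on a line to their span. That
  -- span contains every function vanishing on the diagonal, in particular one whose permuted Gram
  -- matrix is the identity.
  let W : Submodule ℝ (Matrix (Fin n) (Fin n) ℝ) :=
    { carrier := {S | ∀ u, A.mulVec u = 0 → S.mulVec u ∈ LinearMap.range A.mulVecLin}
      add_mem' := fun {S T} hS hT u hu => by
        rw [Matrix.add_mulVec]; exact Submodule.add_mem _ (hS u hu) (hT u hu)
      zero_mem' := fun u _ => by rw [Matrix.zero_mulVec]; exact Submodule.zero_mem _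
      smul_mem' := fun c S hS u hu => by
        rw [Matrix.smul_mulVec]; exact Submodule.smul_mem _ _ (hS u hu) }
  let N := W.comap ((gramMatrix n).comp (LinearMap.funLeft ℝ ℝ σ))
  have hN : Submodule.span ℝ (Set.range lineSqDist) ≤ N := by
    refine Submodule.span_le.2 ?_
    rintro _ ⟨y, rfl⟩
    intro u hu
    refine Matrix.mulVec_mem_range_of_rank_add_smul_le A _ (fun t ht => ?_) u hu
    rw [hrk]
    exact key y t ht.le
  have h1 : (1 : Matrix (Fin n) (Fin n) ℝ) ∈ W := by
    have : ((fun e => if e.IsDiag then 0 else if 0 ∈ e then 1 else 2) ∘ σ.symm :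
        Sym2 (Fin (n + 1)) → ℝ) ∈ N := by
      refine hN (mem_span_range_lineSqDist _ fun e he => ?_)
      have : (σ.symm e).IsDiag := by rw [← hσ]; simpa using he
      simp [this]
    have h2 : gramMatrix n (((fun e => if e.IsDiag then 0 else if 0 ∈ e then 1 else 2) ∘
        σ.symm) ∘ σ) ∈ W := this
    rwa [Function.comp_assoc, Equiv.symm_comp_self, Function.comp_id, gramMatrix_simplex] at h2
  -- The identity maps the kernel of A into its range. As A is symmetric these are orthogonal, so
  -- the kernel is zero and A has rank n > m + 1.
  have hker : ∀ u, A.mulVec u = 0 → u = 0 := by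
    intro u hu
    obtain ⟨v, hv⟩ := h1 u hu
    rw [Matrix.one_mulVec, Matrix.mulVecLin_apply] at hv
    rw [← dotProduct_self_eq_zero]
    nth_rewrite 2 [← hv]
    rw [Matrix.dotProduct_mulVec, ← Matrix.mulVec_transpose, hA, gramMatrix_transpose, ← hA, hu,
      zero_dotProduct]
  have hfull : A.rank = n := by
    have hinj : Function.Injective A.mulVecLin := by
      rw [← LinearMap.ker_eq_bot, LinearMap.ker_eq_bot']
      exact hker
    rw [Matrix.rank, LinearMap.finrank_range_of_inj hinj]
    simp
  omega

end SquaredDistances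

/-! ### Permutations of pairs that preserve rank one are relabelings -/

section Cuts

/-- The pairs with one element in `A` and the other one not in `A`. -/
def cutPairs {k : ℕ} (A : Finset (Fin k)) : Finset (Sym2 (Fin k)) :=
  (A ×ˢ Aᶜ).image fun p => s(p.1, p.2)

theorem mk_mem_cutPairs {k : ℕ} {A : Finset (Fin k)} {i j : Fin k} :
    s(i, j) ∈ cutPairs A ↔ (i ∈ A ∧ j ∉ A) ∨ (j ∈ A ∧ i ∉ A) := by
  simp only [cutPairs, Finset.mem_image, Finset.mem_product, Finset.mem_compl, Prod.exists,
    Sym2.eq_iff]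
  constructor
  · rintro ⟨a, b, h, ⟨rfl, rfl⟩ | ⟨rfl, rfl⟩⟩ <;> tauto
  · rintro (h | h)
    · exact ⟨i, j, h, Or.inl ⟨rfl, rfl⟩⟩
    · exact ⟨j, i, h, Or.inr ⟨rfl, rfl⟩⟩

theorem card_cutPairs {k : ℕ} (A : Finset (Fin k)) :
    (cutPairs A).card = A.card * (k - A.card) := by
  rw [cutPairs, Finset.card_image_of_injOn, Finset.card_product, Finset.card_compl,
    Fintype.card_fin]
  rintro ⟨a, b⟩ h ⟨a', b'⟩ h' heq
  simp only [Finset.coe_product, Set.mem_prod, Finset.mem_coe, Finset.mem_compl] at h h'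
  rcases Sym2.eq_iff.1 heq with ⟨rfl, rfl⟩ | ⟨rfl, rfl⟩
  · rfl
  · exact absurd h'.1 h.2

theorem cutPairs_compl {k : ℕ} (A : Finset (Fin k)) : cutPairs Aᶜ = cutPairs A := by
  ext e
  induction e using Sym2.inductionOn with
  | _ i j => simp only [mk_mem_cutPairs, Finset.mem_compl]; tauto

theorem mk_mem_cutPairs_singleton {k : ℕ} {v i j : Fin k} :
    s(i, j) ∈ cutPairs {v} ↔ i ≠ j ∧ (i = v ∨ j = v) := by
  simp only [mk_mem_cutPairs, Finset.mem_singleton]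
  constructor
  · rintro (⟨rfl, h⟩ | ⟨rfl, h⟩)
    · exact ⟨fun h' => h h'.symm, Or.inl rfl⟩
    · exact ⟨h, Or.inr rfl⟩
  · rintro ⟨h, rfl | rfl⟩
    · exact Or.inl ⟨rfl, fun h' => h h'.symm⟩
    · exact Or.inr ⟨rfl, h⟩

/-- A cut with as many pairs as a star is a star. -/
theorem exists_cutPairs_eq_singleton {n : ℕ} (A : Finset (Fin (n + 1)))
    (hA : (cutPairs A).card = n) (hn : 0 < n) : ∃ c, cutPairs A = cutPairs {c} := by
  rw [card_cutPairs] at hA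
  have hle : A.card ≤ n + 1 := by simpa using Finset.card_le_univ A
  obtain ⟨b, hb⟩ := Nat.exists_eq_add_of_le hle
  have hb' : n + 1 - A.card = b := by omega
  rw [hb'] at hA
  have h1 : A.card = 1 ∨ b = 1 := by
    rcases Nat.eq_zero_or_pos A.card with h | h
    · rw [h] at hA; omega
    rcases Nat.eq_zero_or_pos b with h' | h'
    · rw [h'] at hA; omega
    -- With a + b = n + 1, the equation ab = n means (a - 1)(b - 1) = 0.
    by_contra! hne
    obtain ⟨p, hp⟩ := Nat.exists_eq_add_of_le (show 2 ≤ A.card by omega)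
    obtain ⟨q, hq⟩ := Nat.exists_eq_add_of_le (show 2 ≤ b by omega)
    rw [hp, hq] at hA
    rw [hp, hq] at hb
    nlinarith
  rcases h1 with h | h
  · obtain ⟨c, rfl⟩ := Finset.card_eq_one.1 h
    exact ⟨c, rfl⟩
  · have : Aᶜ.card = 1 := by rw [Finset.card_compl, Fintype.card_fin]; omega
    obtain ⟨c, hc⟩ := Finset.card_eq_one.1 this
    exact ⟨c, by rw [← hc, cutPairs_compl]⟩

theorem Matrix.mul_eq_mul_of_rank_le_one {n : Type*} [Fintype n] [DecidableEq n]
    (A : Matrix n n ℝ) (h : A.rank ≤ 1) (i j : n) : A i i * A j j = A i j * A j i := by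
  have hr : (A.submatrix ![i, j] ![i, j]).rank ≤ 1 := (Matrix.rank_submatrix_le A _ _).trans h
  by_contra hne
  have hdet : (A.submatrix ![i, j] ![i, j]).det ≠ 0 := by
    rw [Matrix.det_fin_two]
    simpa [sub_eq_zero] using hne
  rw [Matrix.rank_of_det_ne_zero hdet] at hr
  simp at hr

theorem lineSqDist_single {k : ℕ} (v : Fin k) (e : Sym2 (Fin k)) :
    lineSqDist (Pi.single v 1) e = if e ∈ cutPairs {v} then 1 else 0 := by
  induction e using Sym2.inductionOn with
  | _ p q =>
    simp only [lineSqDist_mk, mk_mem_cutPairs, Pi.single_apply, Finset.mem_singleton]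
    by_cases hp : p = v <;> by_cases hq : q = v <;> simp [hp, hq]

/-- The star of v is the squared distance function of the indicator of v. Rank one forces its
preimage under σ to be a cut, and its cardinality n forces that cut to be a star. -/
theorem exists_relabeling_of_rank_le_one {n : ℕ} (hn : 2 ≤ n)
    (σ : Equiv.Perm (Sym2 (Fin (n + 1)))) (hσ : ∀ e, (σ e).IsDiag ↔ e.IsDiag)
    (H : ∀ y : Fin (n + 1) → ℝ, (gramMatrix n (lineSqDist y ∘ σ)).rank ≤ 1) :
    ∃ τ : Equiv.Perm (Fin (n + 1)), ∀ p q, p ≠ q → σ s(p, q) = s(τ p, τ q) := by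
  have hdiag : ∀ v p, σ s(p, p) ∉ cutPairs {v} := by
    intro v p
    have h : (σ s(p, p)).IsDiag := by rw [hσ]; exact Sym2.mk_isDiag_iff.2 rfl
    induction hh : σ s(p, p) using Sym2.inductionOn with
    | _ i j =>
      rw [hh, Sym2.mk_isDiag_iff] at h
      rw [mk_mem_cutPairs_singleton]
      tauto
  have hcut : ∀ v, ∃ c, ∀ e, e ∈ cutPairs {c} ↔ σ e ∈ cutPairs {v} := by
    intro v
    let A : Finset (Fin (n + 1)) := Finset.univ.filter fun i => σ s(0, i) ∈ cutPairs {v}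
    have hA : ∀ e, e ∈ cutPairs A ↔ σ e ∈ cutPairs {v} := by
      intro e
      induction e using Sym2.inductionOn with
      | _ i j =>
        rw [mk_mem_cutPairs]
        simp only [A, Finset.mem_filter, Finset.mem_univ, true_and]
        refine Fin.cases ?_ (fun i => ?_) i
        · have := hdiag v 0
          tauto
        refine Fin.cases ?_ (fun j => ?_) j
        · have := hdiag v 0
          rw [Sym2.eq_swap (a := i.succ)]
          tauto
        -- With a, b, c ∈ {0, 1} the values at {0,i}, {0,j}, {i,j}, the minor gives 4ab = (a + b -
        -- c)², that is, c = a xor b.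
        have hmul := Matrix.mul_eq_mul_of_rank_le_one _ (H (Pi.single v 1)) i j
        simp only [gramMatrix_apply, Function.comp_apply, lineSqDist_single, hdiag, if_false,
          Sym2.eq_swap (a := j.succ) (b := i.succ)] at hmul
        by_cases h1 : σ s(0, i.succ) ∈ cutPairs {v} <;>
          by_cases h2 : σ s(0, j.succ) ∈ cutPairs {v} <;>
          by_cases h3 : σ s(i.succ, j.succ) ∈ cutPairs {v} <;>
          simp [h1, h2, h3] at hmul ⊢ <;> norm_num at hmul
    have hcard : (cutPairs A).card = n := by
      have : cutPairs A = (cutPairs {v}).map σ.symm.toEmbedding := by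
        ext e
        rw [hA, Finset.mem_map_equiv]
        simp
      rw [this, Finset.card_map, card_cutPairs]
      simp
    obtain ⟨c, hc⟩ := exists_cutPairs_eq_singleton A hcard (by omega)
    exact ⟨c, fun e => by rw [← hc, hA]⟩
  choose c hc using hcut
  have hinj : Function.Injective c := by
    intro v w hvw
    have heq : ∀ e, e ∈ cutPairs {v} ↔ e ∈ cutPairs {w} := by
      intro e
      have h1 := hc v (σ.symm e)
      have h2 := hc w (σ.symm e)
      rw [hvw, h2] at h1
      simpa using h1.symm
    by_contra hne
    -- A third point exists because n ≥ 2; on two points both stars coincide.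
    obtain ⟨u, hu⟩ : ∃ u, u ∉ ({v, w} : Finset (Fin (n + 1))) := by
      by_contra! hall
      have h1 := Finset.card_le_card (fun x _ => hall x : Finset.univ ⊆ {v, w})
      have h2 := Finset.card_le_two (a := v) (b := w)
      rw [Finset.card_univ, Fintype.card_fin] at h1
      omega
    simp only [Finset.mem_insert, Finset.mem_singleton, not_or] at hu
    have := (heq s(v, u)).1 (mk_mem_cutPairs_singleton.2 ⟨fun h => hu.1 h.symm, Or.inl rfl⟩)
    rcases (mk_mem_cutPairs_singleton.1 this).2 with h | h
    · exact hne h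
    · exact hu.2 h
  let τ := (Equiv.ofBijective c (Finite.injective_iff_bijective.1 hinj)).symm
  have hτ : ∀ p e, e ∈ cutPairs {p} ↔ σ e ∈ cutPairs {τ p} := by
    intro p e
    have : c (τ p) = p :=
      (Equiv.ofBijective c (Finite.injective_iff_bijective.1 hinj)).apply_symm_apply p
    rw [← hc, this]
  refine ⟨τ, fun p q hpq => ?_⟩
  -- The pair {τ p, τ q} is the only one in both the star of τ p and that of τ q.
  have h1 := (hτ p s(p, q)).1 (mk_mem_cutPairs_singleton.2 ⟨hpq, Or.inl rfl⟩)
  have h2 := (hτ q s(p, q)).1 (mk_mem_cutPairs_singleton.2 ⟨hpq, Or.inr rfl⟩)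
  have hne : τ p ≠ τ q := fun h => hpq (τ.injective h)
  induction hh : σ s(p, q) using Sym2.inductionOn with
  | _ i j =>
    rw [hh, mk_mem_cutPairs_singleton] at h1 h2
    rw [Sym2.eq_iff]
    rcases h1.2 with h | h <;> rcases h2.2 with h' | h'
    · exact absurd (h.symm.trans h') hne
    · exact Or.inl ⟨h, h'⟩
    · exact Or.inr ⟨h', h⟩
    · exact absurd (h.symm.trans h') hne

/-- If permuting the squared distances of all configurations of points in dimension `d` leads
to Gram matrices of rank at most `d`, then the permutation comes from one of the points. -/
theorem exists_relabeling_of_rank_le {n d : ℕ} (hd : 1 ≤ d) (hdn : d < n)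
    (σ : Equiv.Perm (Sym2 (Fin (n + 1)))) (hσ : ∀ e, (σ e).IsDiag ↔ e.IsDiag)
    (H : ∀ x : Fin d → Fin (n + 1) → ℝ, (gramMatrix n ((∑ a, lineSqDist (x a)) ∘ σ)).rank ≤ d) :
    ∃ τ : Equiv.Perm (Fin (n + 1)), ∀ p q, p ≠ q → σ s(p, q) = s(τ p, τ q) := by
  induction d, hd using Nat.le_induction with
  | base =>
    refine exists_relabeling_of_rank_le_one hdn σ hσ fun y => ?_
    simpa using H fun _ => y
  | succ m _ ih =>
    exact ih (by omega) (rank_gramMatrix_comp_perm_descent hdn σ hσ H)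

end Cuts

/-- With P and Q then kept fixed, det (P A Q) is a polynomial in the entries of A whose
non-vanishing certifies rank at least m. -/
theorem Matrix.exists_mul_mul_eq_one_of_le_rank {l n : Type*} [Fintype l] [Fintype n]
    [DecidableEq l] [DecidableEq n] {m : ℕ} (A : Matrix l n ℝ) (h : m ≤ A.rank) :
    ∃ (P : Matrix (Fin m) l ℝ) (Q : Matrix n (Fin m) ℝ), P * A * Q = 1 := by
  let b := Module.finBasis ℝ (LinearMap.range A.mulVecLin)
  choose v hv using fun i => (b i).2
  let Q : Matrix n (Fin m) ℝ := Matrix.of fun i j => v (Fin.castLE h j) i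
  have hcol : (A * Q).col = fun j => (b (Fin.castLE h j) : l → ℝ) := by
    funext j
    rw [← hv]
    rfl
  have hinj : Function.Injective (A * Q).mulVec := by
    rw [Matrix.mulVec_injective_iff, hcol]
    exact (b.linearIndependent.comp _ (Fin.castLE_injective h)).map' (Submodule.subtype _)
      (Submodule.ker_subtype _)
  obtain ⟨g, hg⟩ := LinearMap.exists_leftInverse_of_injective (A * Q).mulVecLin
    (LinearMap.ker_eq_bot.2 hinj)
  refine ⟨LinearMap.toMatrix' g, Q, ?_⟩
  rw [Matrix.mul_assoc, ← LinearMap.toMatrix'_id, ← hg, LinearMap.toMatrix'_comp,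
    ← Matrix.toLin'_apply', LinearMap.toMatrix'_toLin']

theorem Matrix.le_rank_of_det_mul_mul_ne_zero {l n : Type*} [Fintype l] [Fintype n] {m : ℕ}
    (A : Matrix l n ℝ) (P : Matrix (Fin m) l ℝ) (Q : Matrix n (Fin m) ℝ)
    (h : (P * A * Q).det ≠ 0) : m ≤ A.rank := by
  have h1 := Matrix.rank_of_det_ne_zero h
  rw [Fintype.card_fin] at h1
  rw [← h1]
  exact (Matrix.rank_mul_le_left _ _).trans (Matrix.rank_mul_le_right _ _)

/-! ### Generic configurations -/

section FormDistances

variable {d k : ℕ}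

/-- Normalising an orthogonal basis gives coordinates in which squared distances are sums of d
squared distances on lines. -/
theorem LinearMap.BilinForm.exists_equiv_sum_mul (B : LinearMap.BilinForm ℝ (Fin d → ℝ))
    (hsymm : B.IsSymm) (hpos : ∀ x, x ≠ 0 → 0 < B x x) :
    ∃ T : (Fin d → ℝ) ≃ₗ[ℝ] (Fin d → ℝ), ∀ x y, B x y = ∑ a, T x a * T y a := by
  have : Invertible (2 : ℝ) := invertibleOfNonzero two_ne_zero
  obtain ⟨b₀, hb₀⟩ := LinearMap.BilinForm.exists_orthogonal_basis
    (B := B) ⟨fun x y => hsymm.eq x y⟩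
  let b := b₀.reindex (finCongr (Module.finrank_fin_fun ℝ))
  have hb : ∀ i j, i ≠ j → B (b i) (b j) = 0 := by
    intro i j hij
    simp only [b, Module.Basis.reindex_apply]
    exact hb₀ (fun h => hij ((finCongr _).symm.injective h))
  have hbb : ∀ i, 0 < B (b i) (b i) := fun i => hpos _ (b.ne_zero i)
  let c : Fin d → ℝˣ := fun i => Units.mk0 (√(B (b i) (b i))) (Real.sqrt_pos.2 (hbb i)).ne'
  let b' := b.unitsSMul fun i => (c i)⁻¹
  have hb' : ∀ i j, B (b' i) (b' j) = if i = j then 1 else 0 := by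
    intro i j
    simp only [b', Module.Basis.unitsSMul_apply, Units.smul_def, map_smul, LinearMap.smul_apply,
      smul_eq_mul]
    split_ifs with h
    · subst h
      have h1 : (√(B (b i) (b i))) * √(B (b i) (b i)) = B (b i) (b i) :=
        Real.mul_self_sqrt (hbb i).le
      have h2 := (Real.sqrt_pos.2 (hbb i)).ne'
      simp only [c, Units.val_inv_eq_inv_val, Units.val_mk0]
      nth_rewrite 3 [← h1]
      field_simp
    · rw [hb i j h, mul_zero, mul_zero]
  refine ⟨b'.equivFun, fun x y => ?_⟩
  conv_lhs => rw [← b'.sum_equivFun x, ← b'.sum_equivFun y]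
  simp only [map_sum, map_smul, LinearMap.sum_apply, LinearMap.smul_apply, smul_eq_mul, hb',
    mul_ite, mul_one, mul_zero, Finset.sum_ite_eq', Finset.mem_univ, if_true]
  exact Finset.sum_congr rfl fun _ _ => mul_comm _ _

/-- The values `B (μ p - μ q) (μ p - μ q)`, as a function of the pair of `p` and `q`. -/
noncomputable def formSqDist (B : LinearMap.BilinForm ℝ (Fin d → ℝ)) (μ : Fin k → Fin d → ℝ) :
    Sym2 (Fin k) → ℝ :=
  Sym2.lift ⟨fun p q => B (μ p - μ q) (μ p - μ q), fun p q => by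
    beta_reduce
    rw [← neg_sub (μ q), map_neg, map_neg, LinearMap.neg_apply, neg_neg]⟩

@[simp]
theorem formSqDist_mk (B : LinearMap.BilinForm ℝ (Fin d → ℝ)) (μ : Fin k → Fin d → ℝ)
    (p q : Fin k) : formSqDist B μ s(p, q) = B (μ p - μ q) (μ p - μ q) := rfl

theorem formSqDist_of_isDiag (B : LinearMap.BilinForm ℝ (Fin d → ℝ)) (μ : Fin k → Fin d → ℝ)
    {e : Sym2 (Fin k)} (he : e.IsDiag) : formSqDist B μ e = 0 := by
  induction e using Sym2.inductionOn with
  | _ p q =>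
    rw [Sym2.mk_isDiag_iff] at he
    simp [he]

theorem formSqDist_eq_sum (B : LinearMap.BilinForm ℝ (Fin d → ℝ))
    (T : (Fin d → ℝ) ≃ₗ[ℝ] (Fin d → ℝ)) (hT : ∀ x y, B x y = ∑ a, T x a * T y a)
    (μ : Fin k → Fin d → ℝ) : formSqDist B μ = ∑ a, lineSqDist fun p => T (μ p) a := by
  funext e
  induction e using Sym2.inductionOn with
  | _ p q =>
    rw [formSqDist_mk, hT]
    simp only [map_sub, Pi.sub_apply, Finset.sum_apply, lineSqDist_mk, pow_two]

theorem exists_mvPolynomial_formSqDist (B : LinearMap.BilinForm ℝ (Fin d → ℝ))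
    (e : Sym2 (Fin k)) : ∃ f : MvPolynomial (Fin k × Fin d) ℝ,
      ∀ μ : Fin k → Fin d → ℝ, MvPolynomial.eval (fun p => μ p.1 p.2) f = formSqDist B μ e := by
  induction e using Sym2.inductionOn with
  | _ p q =>
    refine ⟨∑ a, ∑ b, (MvPolynomial.X (p, a) - MvPolynomial.X (q, a)) *
      MvPolynomial.C (LinearMap.BilinForm.toMatrix' B a b) *
      (MvPolynomial.X (p, b) - MvPolynomial.X (q, b)), fun μ => ?_⟩
    rw [formSqDist_mk]
    conv_rhs => rw [← Matrix.toBilin'_toMatrix' B]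
    rw [Matrix.toBilin'_apply]
    simp [map_sum]

theorem exists_mvPolynomial_rank (B : LinearMap.BilinForm ℝ (Fin d → ℝ)) {n m : ℕ}
    (σ : Equiv.Perm (Sym2 (Fin (n + 1)))) (μ₀ : Fin (n + 1) → Fin d → ℝ)
    (h : m ≤ (gramMatrix n (formSqDist B μ₀ ∘ σ)).rank) :
    ∃ f : MvPolynomial (Fin (n + 1) × Fin d) ℝ, f ≠ 0 ∧ ∀ μ : Fin (n + 1) → Fin d → ℝ,
      MvPolynomial.eval (fun p => μ p.1 p.2) f ≠ 0 →
        m ≤ (gramMatrix n (formSqDist B μ ∘ σ)).rank := by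
  obtain ⟨P, Q, hPQ⟩ := Matrix.exists_mul_mul_eq_one_of_le_rank _ h
  choose g hg using exists_mvPolynomial_formSqDist (k := n + 1) B
  let f : MvPolynomial (Fin (n + 1) × Fin d) ℝ :=
    (P.map (MvPolynomial.C (σ := Fin (n + 1) × Fin d)) *
      (Matrix.of fun i j : Fin n =>
        (g (σ s(0, i.succ)) + g (σ s(0, j.succ)) - g (σ s(i.succ, j.succ))) *
          MvPolynomial.C (1 / 2) : Matrix (Fin n) (Fin n) (MvPolynomial (Fin (n + 1) × Fin d) ℝ)) *
      Q.map (MvPolynomial.C (σ := Fin (n + 1) × Fin d))).det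
  have hf : ∀ μ : Fin (n + 1) → Fin d → ℝ, MvPolynomial.eval (fun p => μ p.1 p.2) f =
      (P * gramMatrix n (formSqDist B μ ∘ σ) * Q).det := by
    intro μ
    simp only [f]
    rw [RingHom.map_det]
    simp only [RingHom.mapMatrix_apply, Matrix.map_mul]
    congr 3
    · ext i j; simp
    · ext i j
      simp [gramMatrix_apply, hg]
      ring
    · ext i j; simp
  refine ⟨f, fun h0 => ?_, fun μ hμ => ?_⟩
  · have := hf μ₀
    rw [h0, hPQ] at this
    simp at this
  · rw [hf] at hμ
    exact Matrix.le_rank_of_det_mul_mul_ne_zero _ _ _ hμ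

/-- Some endpoint v of e' is not in e; moving only v away from the origin separates the two values.
A diagonal e is allowed, which yields non-zero distances. -/
theorem exists_mvPolynomial_ne (B : LinearMap.BilinForm ℝ (Fin d → ℝ)) (hd : 1 ≤ d)
    (hpos : ∀ x, x ≠ 0 → 0 < B x x) (e e' : Sym2 (Fin k)) (he' : ¬ e'.IsDiag) (hne : e ≠ e') :
    ∃ f : MvPolynomial (Fin k × Fin d) ℝ, f ≠ 0 ∧ ∀ μ : Fin k → Fin d → ℝ,
      MvPolynomial.eval (fun p => μ p.1 p.2) f ≠ 0 → formSqDist B μ e ≠ formSqDist B μ e' := by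
  choose g hg using exists_mvPolynomial_formSqDist (k := k) B
  refine ⟨g e' - g e, fun h0 => ?_, fun μ hμ h => hμ ?_⟩
  · obtain ⟨v, hv', hv⟩ : ∃ v, v ∈ e' ∧ v ∉ e := by
      induction e' using Sym2.inductionOn with
      | _ p q =>
        rw [Sym2.mk_isDiag_iff] at he'
        by_contra! hall
        exact hne ((Sym2.mem_and_mem_iff he').1
          ⟨hall p (Sym2.mem_mk_left p q), hall q (Sym2.mem_mk_right p q)⟩)
    let x : Fin d → ℝ := Pi.single ⟨0, hd⟩ 1
    have hx : x ≠ 0 := by simp [x]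
    let μ : Fin k → Fin d → ℝ := Pi.single v x
    have h1 := hg e' μ
    have h2 := hg e μ
    have h3 : formSqDist B μ e = 0 := by
      induction e using Sym2.inductionOn with
      | _ p q =>
        rw [Sym2.mem_iff, not_or] at hv
        simp [μ, Ne.symm hv.1, Ne.symm hv.2]
    have h4 : formSqDist B μ e' = B x x := by
      induction e' using Sym2.inductionOn with
      | _ p q =>
        rw [Sym2.mk_isDiag_iff] at he'
        rcases Sym2.mem_iff.1 hv' with rfl | rfl
        · simp [μ, Ne.symm he']
        · simp [μ, he']
    rw [sub_eq_zero] at h0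
    rw [h0, h2, h3, h4] at h1
    exact (hpos x hx).ne h1
  · rw [map_sub, hg, hg, h, sub_self]

/-- Generic configurations of more than `d + 1` points in dimension `d` have distinct non-zero
squared distances, and are determined by the set of these up to the numbering of the points. -/
theorem exists_mvPolynomial_generic {n : ℕ} (B : LinearMap.BilinForm ℝ (Fin d → ℝ)) (hd : 1 ≤ d)
    (hdn : d < n) (hsymm : B.IsSymm) (hpos : ∀ x, x ≠ 0 → 0 < B x x) :
    ∃ f : MvPolynomial (Fin (n + 1) × Fin d) ℝ, f ≠ 0 ∧ ∀ μ : Fin (n + 1) → Fin d → ℝ,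
      MvPolynomial.eval (fun p => μ p.1 p.2) f ≠ 0 →
        (∀ e e', ¬ e'.IsDiag → formSqDist B μ e = formSqDist B μ e' → e = e') ∧
        ∀ (σ : Equiv.Perm (Sym2 (Fin (n + 1)))), (∀ e, (σ e).IsDiag ↔ e.IsDiag) →
          ∀ μ' : Fin (n + 1) → Fin d → ℝ, formSqDist B μ' = formSqDist B μ ∘ σ →
            ∃ τ : Equiv.Perm (Fin (n + 1)), ∀ p q, p ≠ q → σ s(p, q) = s(τ p, τ q) := by
  obtain ⟨T, hT⟩ := B.exists_equiv_sum_mul hsymm hpos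
  have hne : ∀ z : Sym2 (Fin (n + 1)) × Sym2 (Fin (n + 1)),
      ∃ f : MvPolynomial (Fin (n + 1) × Fin d) ℝ, f ≠ 0 ∧ ∀ μ : Fin (n + 1) → Fin d → ℝ,
        MvPolynomial.eval (fun p => μ p.1 p.2) f ≠ 0 →
          ¬ z.2.IsDiag → formSqDist B μ z.1 = formSqDist B μ z.2 → z.1 = z.2 := by
    intro z
    by_cases h : ¬ z.2.IsDiag ∧ z.1 ≠ z.2
    · obtain ⟨f, hf0, hf⟩ := exists_mvPolynomial_ne B hd hpos z.1 z.2 h.1 h.2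
      exact ⟨f, hf0, fun μ hμ _ heq => absurd heq (hf μ hμ)⟩
    · refine ⟨1, one_ne_zero, fun μ _ h1 _ => ?_⟩
      by_contra h2
      exact h ⟨h1, h2⟩
  have hrel : ∀ σ : Equiv.Perm (Sym2 (Fin (n + 1))),
      ∃ f : MvPolynomial (Fin (n + 1) × Fin d) ℝ, f ≠ 0 ∧ ∀ μ : Fin (n + 1) → Fin d → ℝ,
        MvPolynomial.eval (fun p => μ p.1 p.2) f ≠ 0 → (∀ e, (σ e).IsDiag ↔ e.IsDiag) →
          ∀ μ' : Fin (n + 1) → Fin d → ℝ, formSqDist B μ' = formSqDist B μ ∘ σ →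
            ∃ τ : Equiv.Perm (Fin (n + 1)), ∀ p q, p ≠ q → σ s(p, q) = s(τ p, τ q) := by
    intro σ
    -- Either one configuration violates the rank bound, so generic μ do and no μ' exists, or none
    -- does and the cut argument applies to σ.
    by_cases h : ∃ μ₀ : Fin (n + 1) → Fin d → ℝ,
        d + 1 ≤ (gramMatrix n (formSqDist B μ₀ ∘ σ)).rank
    · obtain ⟨μ₀, hμ₀⟩ := h
      obtain ⟨f, hf0, hf⟩ := exists_mvPolynomial_rank B σ μ₀ hμ₀
      refine ⟨f, hf0, fun μ hμ _ μ' hμ' => ?_⟩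
      have h1 := hf μ hμ
      rw [← hμ', formSqDist_eq_sum B T hT] at h1
      have h2 := rank_gramMatrix_sum_lineSqDist_le (fun a p => T (μ' p) a)
      omega
    · push Not at h
      refine ⟨1, one_ne_zero, fun μ _ hσ _ _ => ?_⟩
      refine exists_relabeling_of_rank_le hd hdn σ hσ fun x => ?_
      have := h fun p => T.symm fun a => x a p
      rw [formSqDist_eq_sum B T hT] at this
      simp only [LinearEquiv.apply_symm_apply] at this
      exact Nat.lt_succ_iff.1 this
  choose f hf0 hf using hne
  choose g hg0 hg using hrel
  refine ⟨(∏ z, f z) * ∏ σ, g σ, mul_ne_zero (Finset.prod_ne_zero_iff.2 fun z _ => hf0 z)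
    (Finset.prod_ne_zero_iff.2 fun σ _ => hg0 σ), fun μ hμ => ?_⟩
  rw [map_mul, map_prod, map_prod] at hμ
  have h1 := Finset.prod_ne_zero_iff.1 (left_ne_zero_of_mul hμ)
  have h2 := Finset.prod_ne_zero_iff.1 (right_ne_zero_of_mul hμ)
  exact ⟨fun e e' => hf (e, e') μ (h1 _ (Finset.mem_univ _)),
    fun σ => hg σ μ (h2 _ (Finset.mem_univ _))⟩

end FormDistances

/-! ### Positivity of the form, and the Laplace transform of the law of Δ -/

open MeasureTheory
open scoped Pointwise

section Gaussian

variable {d k : ℕ}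

/-- The centred Gaussian density attached to the bilinear form `B`. -/
noncomputable def formGaussian (B : LinearMap.BilinForm ℝ (Fin d → ℝ)) (x : Fin d → ℝ) : ℝ :=
  √|(LinearMap.BilinForm.toMatrix' B).det| / √((2 * Real.pi) ^ d) *
    Real.exp (-(1 / 2) * B x x)

theorem mixtureDensity_eq (B : LinearMap.BilinForm ℝ (Fin d → ℝ)) (w : Fin k → ℝ)
    (μ : Fin k → Fin d → ℝ) (x : Fin d → ℝ) :
    mixtureDensity B w μ x = ∑ i, w i * formGaussian B (x - μ i) := by
  simp only [mixtureDensity, formGaussian, mul_assoc]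

theorem LinearMap.BilinForm.continuous_apply_self (B : LinearMap.BilinForm ℝ (Fin d → ℝ)) :
    Continuous fun x => B x x := by
  rw [← Matrix.toBilin'_toMatrix' B]
  simp only [Matrix.toBilin'_apply]
  fun_prop

theorem continuous_formGaussian (B : LinearMap.BilinForm ℝ (Fin d → ℝ)) :
    Continuous (formGaussian B) :=
  continuous_const.mul (Real.continuous_exp.comp (continuous_const.mul B.continuous_apply_self))

theorem continuous_mixtureDensity (B : LinearMap.BilinForm ℝ (Fin d → ℝ)) (w : Fin k → ℝ)
    (μ : Fin k → Fin d → ℝ) : Continuous (mixtureDensity B w μ) := by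
  have h : mixtureDensity B w μ = fun x => ∑ i, w i * formGaussian B (x - μ i) :=
    funext (mixtureDensity_eq B w μ)
  rw [h]
  have := continuous_formGaussian B
  fun_prop

theorem formGaussian_const_pos (B : LinearMap.BilinForm ℝ (Fin d → ℝ)) (hB : B.Nondegenerate) :
    0 < √|(LinearMap.BilinForm.toMatrix' B).det| / √((2 * Real.pi) ^ d) := by
  have h1 : (LinearMap.BilinForm.toMatrix' B).det ≠ 0 :=
    Matrix.nondegenerate_iff_det_ne_zero.1 (LinearMap.BilinForm.nondegenerate_toMatrix'_iff.2 hB)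
  have h2 : 0 < |(LinearMap.BilinForm.toMatrix' B).det| := abs_pos.2 h1
  positivity

theorem formGaussian_pos (B : LinearMap.BilinForm ℝ (Fin d → ℝ)) (hB : B.Nondegenerate)
    (x : Fin d → ℝ) : 0 < formGaussian B x :=
  mul_pos (formGaussian_const_pos B hB) (Real.exp_pos _)

theorem lintegral_formGaussian_lt_top (B : LinearMap.BilinForm ℝ (Fin d → ℝ))
    (hB : B.Nondegenerate) (w : Fin k → ℝ) (μ : Fin k → Fin d → ℝ) (hw : ∀ i, 0 < w i)
    (hP : IsProbabilityMeasure (mixtureMeasure B w μ)) (i : Fin k) :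
    ∫⁻ x, ENNReal.ofReal (formGaussian B x) < ⊤ := by
  have h1 : mixtureMeasure B w μ Set.univ = 1 := measure_univ
  rw [mixtureMeasure, withDensity_apply _ MeasurableSet.univ, Measure.restrict_univ] at h1
  have h2 : ENNReal.ofReal (w i) * ∫⁻ x, ENNReal.ofReal (formGaussian B x) ≤ 1 := by
    rw [← h1, ← lintegral_sub_right_eq_self _ (μ i),
      ← lintegral_const_mul' _ _ ENNReal.ofReal_ne_top]
    refine lintegral_mono fun x => ?_
    rw [← ENNReal.ofReal_mul (hw i).le, mixtureDensity_eq]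
    exact ENNReal.ofReal_le_ofReal (Finset.single_le_sum
      (f := fun j => w j * formGaussian B (x - μ j))
      (fun j _ => (mul_pos (hw j) (formGaussian_pos B hB _)).le) (Finset.mem_univ i))
  by_contra htop
  rw [not_lt, top_le_iff] at htop
  rw [htop, ENNReal.mul_top (by simpa using hw i)] at h2
  simp at h2

theorem LinearMap.BilinForm.exists_apply_self_neg (B : LinearMap.BilinForm ℝ (Fin d → ℝ))
    (hB : B.Nondegenerate) (hsymm : B.IsSymm) (h : ¬ ∀ x, x ≠ 0 → 0 < B x x) :
    ∃ v, B v v < 0 := by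
  push Not at h
  obtain ⟨x, hx, hle⟩ := h
  rcases hle.lt_or_eq with hlt | h0
  · exact ⟨x, hlt⟩
  obtain ⟨u, hu⟩ : ∃ u, B x u ≠ 0 := by
    by_contra! hall
    exact hx (hB.1 x hall)
  -- Since x is isotropic, the form is affine in the coefficient of x; this coefficient makes its
  -- value -1.
  refine ⟨u - ((B u u + 1) / (2 * B x u)) • x, ?_⟩
  simp only [map_sub, LinearMap.sub_apply, map_smul, LinearMap.smul_apply, smul_eq_mul, h0,
    hsymm.eq u x]
  have : B u u + 1 = (B u u + 1) / (2 * B x u) * (2 * B x u) := by field_simp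
  linarith

/-- The negative cone is invariant under doubling, which multiplies volume by 2^d > 1; being open
and non-empty, it has infinite volume. -/
theorem volume_setOf_apply_self_neg (B : LinearMap.BilinForm ℝ (Fin d → ℝ)) (v : Fin d → ℝ)
    (hv : B v v < 0) : volume {x | B x x < 0} = ⊤ := by
  have hd : d ≠ 0 := by
    rintro rfl
    rw [Subsingleton.elim v 0, map_zero] at hv
    exact lt_irrefl _ hv
  have hopen : IsOpen {x | B x x < 0} := isOpen_lt B.continuous_apply_self continuous_const
  have hpos : volume {x | B x x < 0} ≠ 0 := (hopen.measure_pos volume ⟨v, hv⟩).ne'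
  have hsmul : (2 : ℝ) • {x | B x x < 0} = {x | B x x < 0} := by
    ext x
    rw [Set.mem_smul_set_iff_inv_smul_mem₀ two_ne_zero]
    simp only [Set.mem_ofPred_eq, map_smul, LinearMap.smul_apply, smul_eq_mul]
    constructor <;> intro h <;> linarith
  have h1 := Measure.addHaar_smul volume (2 : ℝ) {x | B x x < 0}
  rw [hsmul, Module.finrank_fin_fun] at h1
  by_contra htop
  have h2 : ENNReal.ofReal |(2 : ℝ) ^ d| = 1 := by
    rw [← ENNReal.mul_left_inj hpos htop, one_mul, ← h1]
  rw [ENNReal.ofReal_eq_one, abs_of_pos (by positivity)] at h2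
  exact (one_lt_pow₀ (one_lt_two : (1 : ℝ) < 2) hd).ne' h2

/-- A mixture of Gaussians can only be a probability density if the form is positive definite. -/
theorem pos_of_isProbabilityMeasure_mixtureMeasure (B : LinearMap.BilinForm ℝ (Fin d → ℝ))
    (hB : B.Nondegenerate) (hsymm : B.IsSymm) (w : Fin k → ℝ) (μ : Fin k → Fin d → ℝ)
    (hw : ∀ i, 0 < w i) (hP : IsProbabilityMeasure (mixtureMeasure B w μ)) (i : Fin k) :
    ∀ x, x ≠ 0 → 0 < B x x := by
  by_contra h
  obtain ⟨v, hv⟩ := B.exists_apply_self_neg hB hsymm h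
  have h1 := lintegral_formGaussian_lt_top B hB w μ hw hP i
  -- On the negative cone the Gaussian is at least its normalising constant.
  have h2 : ENNReal.ofReal (√|(LinearMap.BilinForm.toMatrix' B).det| / √((2 * Real.pi) ^ d)) *
      volume {x | B x x < 0} ≤ ∫⁻ x, ENNReal.ofReal (formGaussian B x) := by
    rw [← setLIntegral_const]
    refine (setLIntegral_mono' (isOpen_lt B.continuous_apply_self
      continuous_const).measurableSet fun x hx => ?_).trans (setLIntegral_le_lintegral _ _)
    refine ENNReal.ofReal_le_ofReal (le_mul_of_one_le_right (by positivity) ?_)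
    rw [Real.one_le_exp_iff]
    have : B x x < 0 := hx
    linarith
  rw [volume_setOf_apply_self_neg B v hv,
    ENNReal.mul_top (by simpa using formGaussian_const_pos B hB)] at h2
  exact absurd h1 (not_lt.2 h2)

/-- The Laplace transform at `s` of the law of `B (x - y) (x - y)` for independent centred
Gaussians `x` and `y`. -/
noncomputable def gaussianLaplace (B : LinearMap.BilinForm ℝ (Fin d → ℝ)) (s : ℝ) : ENNReal :=
  ∫⁻ z : (Fin d → ℝ) × (Fin d → ℝ), ENNReal.ofReal
    (formGaussian B z.1 * formGaussian B z.2 * Real.exp (-s * B (z.1 - z.2) (z.1 - z.2)))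

theorem gaussianLaplace_ne_zero (B : LinearMap.BilinForm ℝ (Fin d → ℝ)) (hB : B.Nondegenerate)
    (s : ℝ) : gaussianLaplace B s ≠ 0 := by
  have hc := B.continuous_apply_self
  have hg := continuous_formGaussian B
  have hm : Measurable fun z : (Fin d → ℝ) × (Fin d → ℝ) => ENNReal.ofReal
      (formGaussian B z.1 * formGaussian B z.2 *
        Real.exp (-s * B (z.1 - z.2) (z.1 - z.2))) := by
    refine ENNReal.measurable_ofReal.comp (Continuous.measurable ?_)
    exact ((hg.comp continuous_fst).mul (hg.comp continuous_snd)).mul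
      (Real.continuous_exp.comp (continuous_const.mul
        (hc.comp (continuous_fst.sub continuous_snd))))
  refine ((lintegral_pos_iff_support hm).2 ?_).ne'
  have : (Function.support fun z : (Fin d → ℝ) × (Fin d → ℝ) => ENNReal.ofReal
      (formGaussian B z.1 * formGaussian B z.2 *
        Real.exp (-s * B (z.1 - z.2) (z.1 - z.2)))) = Set.univ := by
    refine Set.eq_univ_of_forall fun z => ?_
    rw [Function.mem_support, Ne, ENNReal.ofReal_eq_zero, not_le]
    exact mul_pos (mul_pos (formGaussian_pos B hB _) (formGaussian_pos B hB _)) (Real.exp_pos _)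
  rw [this]
  exact isOpen_univ.measure_pos volume Set.univ_nonempty

theorem gaussianLaplace_ne_top (B : LinearMap.BilinForm ℝ (Fin d → ℝ)) (hB : B.Nondegenerate)
    (hnn : ∀ x, 0 ≤ B x x) (hfin : ∫⁻ x, ENNReal.ofReal (formGaussian B x) < ⊤) (s : ℝ)
    (hs : 0 ≤ s) : gaussianLaplace B s ≠ ⊤ := by
  have hm : AEMeasurable (fun x => ENNReal.ofReal (formGaussian B x)) :=
    (ENNReal.measurable_ofReal.comp (continuous_formGaussian B).measurable).aemeasurable
  refine ne_top_of_le_ne_top (ENNReal.mul_lt_top hfin hfin).ne ?_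
  rw [← lintegral_prod_mul hm hm]
  refine lintegral_mono fun z => ?_
  rw [← ENNReal.ofReal_mul (formGaussian_pos B hB _).le]
  refine ENNReal.ofReal_le_ofReal (mul_le_of_le_one_right
    (mul_pos (formGaussian_pos B hB _) (formGaussian_pos B hB _)).le ?_)
  rw [Real.exp_le_one_iff, neg_mul, neg_nonpos]
  exact mul_nonneg hs (hnn _)

/-- Completing the square: with m = p - q, the means are translated towards each other by am. The
cross terms cancel for a = 2s/(1 + 4s), which leaves a² + s(1 - 2a)² = s/(1 + 4s) as the rate in
B(m, m). -/
theorem lintegral_formGaussian_mul_exp (B : LinearMap.BilinForm ℝ (Fin d → ℝ))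
    (hsymm : B.IsSymm) (s : ℝ) (hs : 0 ≤ s) (p q : Fin d → ℝ) :
    ∫⁻ z : (Fin d → ℝ) × (Fin d → ℝ), ENNReal.ofReal
      (formGaussian B (z.1 - p) * formGaussian B (z.2 - q) *
        Real.exp (-s * B (z.1 - z.2) (z.1 - z.2))) =
      ENNReal.ofReal (Real.exp (-(s / (1 + 4 * s)) * B (p - q) (p - q))) *
        gaussianLaplace B s := by
  have h4 : 1 + 4 * s ≠ 0 := by positivity
  have hinv : (volume : Measure ((Fin d → ℝ) × (Fin d → ℝ))).IsAddRightInvariant := by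
    rw [Measure.volume_eq_prod]
    infer_instance
  rw [gaussianLaplace, ← lintegral_const_mul' _ _ ENNReal.ofReal_ne_top,
    ← lintegral_add_right_eq_self _ (p - (2 * s / (1 + 4 * s)) • (p - q),
      q + (2 * s / (1 + 4 * s)) • (p - q))]
  refine lintegral_congr fun z => ?_
  rw [← ENNReal.ofReal_mul (Real.exp_pos _).le]
  congr 1
  obtain ⟨x, y⟩ := z
  simp only [Prod.fst_add, Prod.snd_add]
  set a := 2 * s / (1 + 4 * s) with ha
  have e1 : x + (p - a • (p - q)) - p = x - a • (p - q) := by abel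
  have e2 : y + (q + a • (p - q)) - q = y + a • (p - q) := by abel
  have e3 : x + (p - a • (p - q)) - (y + (q + a • (p - q))) =
      (x - y) + (1 - 2 * a) • (p - q) := by module
  rw [e1, e2, e3]
  generalize p - q = m
  have key : -(1 / 2) * B (x - a • m) (x - a • m) + -(1 / 2) * B (y + a • m) (y + a • m) +
      -s * B ((x - y) + (1 - 2 * a) • m) ((x - y) + (1 - 2 * a) • m) =
      -(s / (1 + 4 * s)) * B m m + (-(1 / 2) * B x x + -(1 / 2) * B y y +
        -s * B (x - y) (x - y)) := by
    simp only [map_add, map_sub, map_smul, LinearMap.add_apply, LinearMap.sub_apply,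
      LinearMap.smul_apply, smul_eq_mul, hsymm.eq m x, hsymm.eq m y, hsymm.eq y x]
    rw [ha]
    field_simp
    ring
  simp only [formGaussian]
  have h := congrArg Real.exp key
  simp only [Real.exp_add] at h
  linear_combination (√|(LinearMap.BilinForm.toMatrix' B).det| / √((2 * Real.pi) ^ d)) ^ 2 * h

theorem lintegral_exp_deltaLaw (B : LinearMap.BilinForm ℝ (Fin d → ℝ)) (hB : B.Nondegenerate)
    (hsymm : B.IsSymm) (w : Fin k → ℝ) (μ : Fin k → Fin d → ℝ) (hw : ∀ i, 0 < w i) (s : ℝ)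
    (hs : 0 ≤ s) :
    ∫⁻ δ, ENNReal.ofReal (Real.exp (-s * δ)) ∂(deltaLaw B (mixtureMeasure B w μ)) =
      ENNReal.ofReal (∑ z : Fin k × Fin k, w z.1 * w z.2 *
        Real.exp (-(s / (1 + 4 * s)) * formSqDist B μ s(z.1, z.2))) * gaussianLaplace B s := by
  have hc := B.continuous_apply_self
  have hg := continuous_formGaussian B
  have hΔ : Continuous fun z : (Fin d → ℝ) × (Fin d → ℝ) => B (z.1 - z.2) (z.1 - z.2) :=
    hc.comp (continuous_fst.sub continuous_snd)
  have hexp : Measurable fun δ : ℝ => ENNReal.ofReal (Real.exp (-s * δ)) := by fun_prop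
  have hρ : Measurable fun x => ENNReal.ofReal (mixtureDensity B w μ x) :=
    ENNReal.measurable_ofReal.comp (continuous_mixtureDensity B w μ).measurable
  have hρρ : Measurable fun z : (Fin d → ℝ) × (Fin d → ℝ) =>
      ENNReal.ofReal (mixtureDensity B w μ z.1) * ENNReal.ofReal (mixtureDensity B w μ z.2) :=
    (hρ.comp measurable_fst).mul (hρ.comp measurable_snd)
  have hpair : ∀ z : Fin k × Fin k, 0 ≤ w z.1 * w z.2 := fun z => (mul_pos (hw _) (hw _)).le
  rw [deltaLaw, lintegral_map hexp hΔ.measurable, mixtureMeasure, prod_withDensity hρ hρ,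
    lintegral_withDensity_eq_lintegral_mul _ hρρ
      (g := fun z => ENNReal.ofReal (Real.exp (-s * B (z.1 - z.2) (z.1 - z.2))))
      (hexp.comp hΔ.measurable)]
  have hpt : ∀ z : (Fin d → ℝ) × (Fin d → ℝ),
      ((fun z : (Fin d → ℝ) × (Fin d → ℝ) => ENNReal.ofReal (mixtureDensity B w μ z.1) *
        ENNReal.ofReal (mixtureDensity B w μ z.2)) *
        (fun z : (Fin d → ℝ) × (Fin d → ℝ) =>
          ENNReal.ofReal (Real.exp (-s * B (z.1 - z.2) (z.1 - z.2))))) z =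
      ∑ i : Fin k × Fin k, ENNReal.ofReal (w i.1 * w i.2) * ENNReal.ofReal
        (formGaussian B (z.1 - μ i.1) * formGaussian B (z.2 - μ i.2) *
          Real.exp (-s * B (z.1 - z.2) (z.1 - z.2))) := by
    intro z
    have hnn : ∀ i x, 0 ≤ w i * formGaussian B (x - μ i) :=
      fun i x => (mul_pos (hw _) (formGaussian_pos B hB _)).le
    simp only [Pi.mul_apply, mixtureDensity_eq]
    rw [← ENNReal.ofReal_mul (Finset.sum_nonneg fun i _ => hnn i _), ← ENNReal.ofReal_mul
      (mul_nonneg (Finset.sum_nonneg fun i _ => hnn i _) (Finset.sum_nonneg fun i _ => hnn i _)),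
      Finset.sum_mul_sum, ← Fintype.sum_prod_type', Finset.sum_mul, ENNReal.ofReal_sum_of_nonneg]
    · refine Finset.sum_congr rfl fun i _ => ?_
      rw [← ENNReal.ofReal_mul (hpair i)]
      congr 1
      ring
    · intro i _
      exact mul_nonneg (mul_nonneg (hnn _ _) (hnn _ _)) (Real.exp_pos _).le
  rw [lintegral_congr hpt, lintegral_finsetSum]
  · rw [ENNReal.ofReal_sum_of_nonneg fun i _ => mul_nonneg (hpair i) (Real.exp_pos _).le,
      Finset.sum_mul]
    refine Finset.sum_congr rfl fun i _ => ?_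
    rw [lintegral_const_mul' _ _ ENNReal.ofReal_ne_top]
    have := lintegral_formGaussian_mul_exp B hsymm s hs (μ i.1) (μ i.2)
    rw [Measure.volume_eq_prod] at this
    rw [this, ENNReal.ofReal_mul (hpair i), mul_assoc, formSqDist_mk]
  · intro i _
    refine (ENNReal.measurable_ofReal.comp (Continuous.measurable ?_)).const_mul _
    exact ((hg.comp (continuous_fst.sub continuous_const)).mul
      (hg.comp (continuous_snd.sub continuous_const))).mul
      (Real.continuous_exp.comp (continuous_const.mul hΔ))

theorem sum_mul_exp_eq_of_deltaLaw_eq (B : LinearMap.BilinForm ℝ (Fin d → ℝ))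
    (hB : B.Nondegenerate) (hsymm : B.IsSymm) (hpos : ∀ x, x ≠ 0 → 0 < B x x)
    (hfin : ∫⁻ x, ENNReal.ofReal (formGaussian B x) < ⊤) (w w' : Fin k → ℝ)
    (μ μ' : Fin k → Fin d → ℝ) (hw : ∀ i, 0 < w i) (hw' : ∀ i, 0 < w' i)
    (h : deltaLaw B (mixtureMeasure B w' μ') = deltaLaw B (mixtureMeasure B w μ)) (t : ℝ)
    (ht : 0 < t) (ht4 : t < 1 / 4) :
    ∑ z : Fin k × Fin k, w' z.1 * w' z.2 * Real.exp (-t * formSqDist B μ' s(z.1, z.2)) =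
      ∑ z : Fin k × Fin k, w z.1 * w z.2 * Real.exp (-t * formSqDist B μ s(z.1, z.2)) := by
  -- The substitution s = t/(1 - 4t) inverts t = s/(1 + 4s), whose values stay below 1/4.
  have hs : 0 ≤ t / (1 - 4 * t) := div_nonneg ht.le (by linarith)
  have hst : t / (1 - 4 * t) / (1 + 4 * (t / (1 - 4 * t))) = t := by
    have h0 : 1 - 4 * t ≠ 0 := by linarith
    have h1 : 1 + 4 * (t / (1 - 4 * t)) = 1 / (1 - 4 * t) := by
      field_simp
      ring
    rw [h1, div_div_div_cancel_right₀ h0, div_one]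
  have hnn : ∀ x, 0 ≤ B x x := by
    intro x
    rcases eq_or_ne x 0 with rfl | hx
    · simp
    · exact (hpos x hx).le
  have h1 := lintegral_exp_deltaLaw B hB hsymm w μ hw _ hs
  rw [← h, lintegral_exp_deltaLaw B hB hsymm w' μ' hw' _ hs, hst, ENNReal.mul_left_inj
    (gaussianLaplace_ne_zero B hB _) (gaussianLaplace_ne_top B hB hnn hfin _ hs)] at h1
  refine (ENNReal.ofReal_eq_ofReal_iff ?_ ?_).1 h1 <;>
    exact Finset.sum_nonneg fun z _ => by
      first
      | exact (mul_pos (mul_pos (hw _) (hw _)) (Real.exp_pos _)).le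
      | exact (mul_pos (mul_pos (hw' _) (hw' _)) (Real.exp_pos _)).le

end Gaussian

/-! ### Linear independence of exponentials -/

/-- Exponentials with distinct rates are linearly independent on every interval `(0, ε)`. -/
theorem sum_filter_eq_zero_of_sum_mul_exp_eq_zero {ι : Type*} [Fintype ι] (a x : ι → ℝ) (ε : ℝ)
    (hε : 0 < ε) (h : ∀ t, 0 < t → t < ε → ∑ i, a i * Real.exp (-t * x i) = 0) (δ : ℝ) :
    ∑ i with x i = δ, a i = 0 := by
  let S := Finset.univ.image x
  by_cases hδ : δ ∈ S
  swap
  · rw [Finset.filter_false_of_mem, Finset.sum_empty]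
    rintro i - rfl
    exact hδ (Finset.mem_image_of_mem _ (Finset.mem_univ i))
  let e := S.equivFin
  let c : ℝ → ℝ := fun δ => ∑ i with x i = δ, a i
  -- The sample points η, 2η, …, |S|η all lie in (0, ε), and give a Vandermonde system with nodes
  -- exp(-ηδ).
  let η : ℝ := ε / (S.card + 1)
  have hη : 0 < η := by positivity
  let f : Fin S.card → ℝ := fun m => Real.exp (-η * (e.symm m : ℝ))
  have hf : Function.Injective f := by
    intro m m' hmm
    have h1 := Real.exp_injective hmm
    have h2 := mul_left_cancel₀ (neg_ne_zero.2 hη.ne') h1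
    exact e.symm.injective (Subtype.ext h2)
  -- Vandermonde powers start at 0 but t = 0 is excluded, so one factor of each node is absorbed
  -- into the coefficient.
  have hv := Matrix.eq_zero_of_forall_pow_sum_mul_pow_eq_zero
    (v := fun m => c (e.symm m) * f m) hf (fun m => by
      have hm : ((m : ℕ) + 1 : ℝ) * η < ε := by
        have h1 : ((m : ℕ) + 1 : ℝ) < S.card + 1 := by
          have : (m : ℕ) < S.card := m.2
          exact_mod_cast Nat.succ_lt_succ this
        calc ((m : ℕ) + 1 : ℝ) * η < (S.card + 1) * η := by gcongr
          _ = ε := by simp only [η]; field_simp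
      rw [← h (((m : ℕ) + 1 : ℝ) * η) (by positivity) hm,
        ← Finset.sum_fiberwise_of_maps_to (s := Finset.univ) (t := S) (g := x)
          (fun i _ => Finset.mem_image_of_mem _ (Finset.mem_univ i)),
        ← Finset.sum_coe_sort S, ← e.symm.sum_comp]
      refine Finset.sum_congr rfl fun l _ => ?_
      rw [mul_assoc, ← pow_succ', ← Real.exp_nat_mul, Finset.sum_mul]
      refine Finset.sum_congr rfl fun i hi => ?_
      rw [(Finset.mem_filter.1 hi).2]
      congr 2
      push_cast
      ring)
  have := congrFun hv (e ⟨δ, hδ⟩)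
  simpa [c, f, Real.exp_ne_zero] using this

theorem sum_filter_eq_of_sum_mul_exp_eq {ι : Type*} [Fintype ι] (a x b y : ι → ℝ) (ε : ℝ)
    (hε : 0 < ε) (h : ∀ t, 0 < t → t < ε →
      ∑ i, a i * Real.exp (-t * x i) = ∑ i, b i * Real.exp (-t * y i)) (δ : ℝ) :
    ∑ i with x i = δ, a i = ∑ i with y i = δ, b i := by
  have h1 := sum_filter_eq_zero_of_sum_mul_exp_eq_zero (Sum.elim a fun i => -b i) (Sum.elim x y)
    ε hε (fun t ht ht' => by
      simp only [Fintype.sum_sum_type, Sum.elim_inl, Sum.elim_inr, neg_mul (b _),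
        Finset.sum_neg_distrib]
      rw [h t ht ht', add_neg_cancel]) δ
  rw [Finset.sum_filter, Fintype.sum_sum_type] at h1
  have h2 : (∑ i, if x i = δ then a i else 0) + ∑ i, (if y i = δ then -b i else 0) = 0 :=
    h1
  rw [← Finset.sum_filter, ← Finset.sum_filter, Finset.sum_neg_distrib] at h2
  linarith

/-! ### Recovering the means and the weights -/

section Recovery

/-- Families of vectors with the same inner products differ by a linear isometry. -/
theorem exists_linearIsometryEquiv_of_inner_eq {E ι : Type*} [NormedAddCommGroup E]
    [InnerProductSpace ℝ E] [FiniteDimensional ℝ E] [Fintype ι] [DecidableEq ι] (x y : ι → E)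
    (h : ∀ i j, inner ℝ (x i) (x j) = inner ℝ (y i) (y j)) :
    ∃ L : E ≃ₗᵢ[ℝ] E, ∀ i, L (x i) = y i := by
  let X := Fintype.linearCombination ℝ x
  let Y := Fintype.linearCombination ℝ y
  have hnorm : ∀ c, ‖X c‖ = ‖Y c‖ := by
    intro c
    rw [← sq_eq_sq₀ (norm_nonneg _) (norm_nonneg _), ← real_inner_self_eq_norm_sq,
      ← real_inner_self_eq_norm_sq]
    simp only [X, Y, Fintype.linearCombination_apply, sum_inner, inner_sum, real_inner_smul_left,
      real_inner_smul_right, h]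
  -- Equal norms make X c ↦ Y c a well-defined isometry on the range of X; the section r of X
  -- realises it as a linear map.
  obtain ⟨r, hr⟩ := LinearMap.exists_rightInverse_of_surjective X.rangeRestrict
    (LinearMap.range_rangeRestrict X)
  have hXr : ∀ s, X (r s) = s := fun s => congrArg Subtype.val (LinearMap.congr_fun hr s)
  let f : LinearMap.range X →ₗᵢ[ℝ] E :=
    { toLinearMap := Y.comp r
      norm_map' := fun s => by
        rw [LinearMap.comp_apply, ← hnorm, hXr]
        rfl }
  let L : E ≃ₗᵢ[ℝ] E := f.extend.toLinearIsometryEquiv rfl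
  refine ⟨L, fun i => ?_⟩
  have hx : X (Pi.single i 1) = x i := by simp [X]
  have hy : Y (Pi.single i 1) = y i := by simp [Y]
  have h1 : L (x i) = Y (r ⟨x i, ⟨_, hx⟩⟩) := f.extend_apply ⟨x i, ⟨_, hx⟩⟩
  rw [h1, ← hy, ← sub_eq_zero, ← map_sub, ← norm_eq_zero, ← hnorm, map_sub, hXr, hx]
  simp

/-- Configurations with the same squared distances differ by an isometry. -/
theorem exists_isOrthogonal_of_formSqDist_eq {d n : ℕ} (B : LinearMap.BilinForm ℝ (Fin d → ℝ))
    (hsymm : B.IsSymm) (hpos : ∀ x, x ≠ 0 → 0 < B x x) (μ ν : Fin (n + 1) → Fin d → ℝ)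
    (h : formSqDist B μ = formSqDist B ν) :
    ∃ (g : (Fin d → ℝ) ≃ₗ[ℝ] (Fin d → ℝ)) (v : Fin d → ℝ), B.IsOrthogonal g ∧
      ∀ p, g (μ p) + v = ν p := by
  obtain ⟨T, hT⟩ := B.exists_equiv_sum_mul hsymm hpos
  let U : (Fin d → ℝ) ≃ₗ[ℝ] EuclideanSpace ℝ (Fin d) :=
    T.trans (WithLp.linearEquiv 2 ℝ (Fin d → ℝ)).symm
  have hU : ∀ x y, inner ℝ (U x) (U y) = B x y := by
    intro x y
    rw [hT]
    simp [U, PiLp.inner_apply, mul_comm]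
  have hpolar : ∀ (κ : Fin (n + 1) → Fin d → ℝ) (p q : Fin (n + 1)),
      B (κ p - κ 0) (κ q - κ 0) =
        (formSqDist B κ s(p, 0) + formSqDist B κ s(q, 0) - formSqDist B κ s(p, q)) / 2 := by
    intro κ p q
    have : κ p - κ q = (κ p - κ 0) - (κ q - κ 0) := by abel
    simp only [formSqDist_mk]
    rw [this]
    generalize κ p - κ 0 = a
    generalize κ q - κ 0 = b
    simp only [map_sub, LinearMap.sub_apply, hsymm.eq b a]
    ring
  obtain ⟨L, hL⟩ := exists_linearIsometryEquiv_of_inner_eq (fun p => U (μ p - μ 0))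
    (fun p => U (ν p - ν 0)) (fun p q => by rw [hU, hU, hpolar, hpolar, h])
  let g := (U.trans L.toLinearEquiv).trans U.symm
  have hg : ∀ x, U (g x) = L (U x) := fun x => by simp [g]
  refine ⟨g, ν 0 - g (μ 0), fun x y => ?_, fun p => ?_⟩
  · rw [← hU, hg, hg, L.inner_map_map, hU]
  · have h1 : g (μ p - μ 0) = ν p - ν 0 := U.injective (by rw [hg, hL])
    rw [map_sub] at h1
    rw [← sub_eq_zero] at h1 ⊢
    rw [← h1]
    abel

/-- At each D e with e off the diagonal the mass is positive, so D' attains that value. As D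
separates the pairs, this gives an injection of a finite set into itself, and σ is its inverse. -/
theorem exists_perm_of_sum_filter_eq {k : ℕ} (D D' : Sym2 (Fin k) → ℝ)
    (hD0 : ∀ e, e.IsDiag → D e = 0) (hD0' : ∀ e, e.IsDiag → D' e = 0)
    (hD : ∀ e e', ¬ e'.IsDiag → D e = D e' → e = e') (w w' : Fin k → ℝ) (hw : ∀ i, 0 < w i)
    (h : ∀ δ, ∑ z : Fin k × Fin k with D' s(z.1, z.2) = δ, w' z.1 * w' z.2 =
      ∑ z : Fin k × Fin k with D s(z.1, z.2) = δ, w z.1 * w z.2) :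
    ∃ σ : Equiv.Perm (Sym2 (Fin k)), (∀ e, (σ e).IsDiag ↔ e.IsDiag) ∧ D' = D ∘ σ := by
  have hex : ∀ e, ∃ e', (e'.IsDiag ↔ e.IsDiag) ∧ D' e' = D e ∧ (e.IsDiag → e' = e) := by
    intro e
    by_cases he : e.IsDiag
    · exact ⟨e, Iff.rfl, by rw [hD0 e he, hD0' e he], fun _ => rfl⟩
    have hne : ∑ z : Fin k × Fin k with D' s(z.1, z.2) = D e, w' z.1 * w' z.2 ≠ 0 := by
      rw [h]
      refine (Finset.sum_pos (fun z _ => mul_pos (hw _) (hw _)) ?_).ne'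
      induction e using Sym2.inductionOn with
      | _ p q => exact ⟨(p, q), by simp⟩
    obtain ⟨z, hz, -⟩ := Finset.exists_ne_zero_of_sum_ne_zero hne
    have hz' := (Finset.mem_filter.1 hz).2
    refine ⟨s(z.1, z.2), iff_of_false (fun hdiag => he ?_) he, hz', fun h => absurd h he⟩
    rw [← hD s(z.1, z.2) e he (by rw [hD0 _ hdiag, ← hz', hD0' _ hdiag])]
    exact hdiag
  choose φ hφd hφ hφ0 using hex
  have hinj : Function.Injective φ := by
    intro e e' hee
    by_cases he' : e'.IsDiag
    · have he : e.IsDiag := by rw [← hφd, hee, hφd]; exact he'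
      rw [← hφ0 e he, hee, hφ0 e' he']
    · exact hD e e' he' (by rw [← hφ, hee, hφ])
  let Φ := Equiv.ofBijective φ (Finite.injective_iff_bijective.1 hinj)
  have hΦ : ∀ e, φ (Φ.symm e) = e := Φ.apply_symm_apply
  refine ⟨Φ.symm, fun e => by rw [← hφd, hΦ], funext fun e => ?_⟩
  rw [Function.comp_apply, ← hφ, hΦ]

theorem sum_filter_mk_eq {k : ℕ} (w : Fin k → ℝ) {p q : Fin k} (hpq : p ≠ q) :
    ∑ z : Fin k × Fin k with s(z.1, z.2) = s(p, q), w z.1 * w z.2 = 2 * (w p * w q) := by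
  have : (Finset.univ.filter fun z : Fin k × Fin k => s(z.1, z.2) = s(p, q)) =
      {(p, q), (q, p)} := by
    ext z
    simp [Prod.ext_iff]
  rw [this, Finset.sum_pair (by simp [hpq])]
  ring

/-- With three distinct indices, a_p² = (a_p a_q)(a_p a_r)/(a_q a_r). -/
theorem weights_eq_of_mul_eq {k : ℕ} (hk : 3 ≤ k) (a b : Fin k → ℝ) (ha : ∀ i, 0 < a i)
    (hb : ∀ i, 0 < b i) (h : ∀ p q, p ≠ q → a p * a q = b p * b q) : a = b := by
  funext p
  obtain ⟨q, hq⟩ : ∃ q, q ∉ ({p} : Finset (Fin k)) := by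
    by_contra! hall
    have h1 := Finset.card_le_card (fun x _ => hall x : Finset.univ ⊆ {p})
    rw [Finset.card_univ, Fintype.card_fin, Finset.card_singleton] at h1
    omega
  obtain ⟨r, hr⟩ : ∃ r, r ∉ ({p, q} : Finset (Fin k)) := by
    by_contra! hall
    have h1 := Finset.card_le_card (fun x _ => hall x : Finset.univ ⊆ {p, q})
    have h2 := Finset.card_le_two (a := p) (b := q)
    rw [Finset.card_univ, Fintype.card_fin] at h1
    omega
  simp only [Finset.mem_insert, Finset.mem_singleton, not_or] at hq hr
  have h1 := h p q (Ne.symm hq)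
  have h2 := h p r (Ne.symm hr.1)
  have h3 := h q r (Ne.symm hr.2)
  have h4 : a p ^ 2 * (a q * a r) = b p ^ 2 * (a q * a r) := by
    calc a p ^ 2 * (a q * a r) = (a p * a q) * (a p * a r) := by ring
      _ = b p ^ 2 * (b q * b r) := by rw [h1, h2]; ring
      _ = b p ^ 2 * (a q * a r) := by rw [h3]
  have h5 := mul_right_cancel₀ (mul_pos (ha q) (ha r)).ne' h4
  exact (sq_eq_sq₀ (ha p).le (hb p).le).1 h5

theorem mixtureDensity_comp_isOrthogonal {d k : ℕ} (B : LinearMap.BilinForm ℝ (Fin d → ℝ))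
    (w w' : Fin k → ℝ) (μ μ' : Fin k → Fin d → ℝ) (τ : Equiv.Perm (Fin k))
    (g : (Fin d → ℝ) ≃ₗ[ℝ] (Fin d → ℝ)) (v : Fin d → ℝ) (hg : B.IsOrthogonal g)
    (hμ : ∀ p, g (μ' p) + v = μ (τ p)) (hw : w' = w ∘ τ) (x : Fin d → ℝ) :
    mixtureDensity B w' μ' x = mixtureDensity B w μ (g x + v) := by
  unfold mixtureDensity
  refine Eq.trans ?_ (Equiv.sum_comp τ _)
  refine Finset.sum_congr rfl fun p _ => ?_
  have : g x + v - μ (τ p) = g (x - μ' p) := by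
    rw [← hμ, map_sub]
    abel
  rw [this, hg, hw, Function.comp_apply]

end Recovery

/-! ### The main theorem -/

theorem theorem3 (d k : ℕ) (hk : d + 2 ≤ k) (B : LinearMap.BilinForm ℝ (Fin d → ℝ))
    (hB : B.Nondegenerate) (hsymm : B.IsSymm) :
    ∃ f : MvPolynomial (Fin k × Fin d) ℝ, f ≠ 0 ∧
      ∀ μ : Fin k → Fin d → ℝ, MvPolynomial.eval (fun p => μ p.1 p.2) f ≠ 0 →
      ∀ w : Fin k → ℝ, (∀ i, 0 < w i) → ∑ i, w i = 1 →
        MeasureTheory.IsProbabilityMeasure (mixtureMeasure B w μ) →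
      ∀ (w' : Fin k → ℝ) (μ' : Fin k → Fin d → ℝ), (∀ i, 0 < w' i) → ∑ i, w' i = 1 →
        MeasureTheory.IsProbabilityMeasure (mixtureMeasure B w' μ') →
        deltaLaw B (mixtureMeasure B w' μ') = deltaLaw B (mixtureMeasure B w μ) →
        ∃ (g : (Fin d → ℝ) ≃ₗ[ℝ] (Fin d → ℝ)) (v : Fin d → ℝ), B.IsOrthogonal g ∧
          ∀ x, mixtureDensity B w' μ' x = mixtureDensity B w μ (g x + v) := by
  obtain ⟨n, rfl⟩ : ∃ n, k = n + 1 := ⟨k - 1, by omega⟩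
  rcases Nat.eq_zero_or_pos d with rfl | hd
  -- In dimension 0 every mixture is the same constant, as the weights sum to 1.
  · refine ⟨1, one_ne_zero, fun μ _ w _ hw1 _ w' μ' _ hw1' _ _ =>
      ⟨LinearEquiv.refl ℝ _, 0, fun x y => rfl, fun x => ?_⟩⟩
    have hconst : ∀ u : Fin 0 → ℝ, formGaussian B u = formGaussian B 0 :=
      fun u => by rw [Subsingleton.elim u 0]
    simp only [mixtureDensity_eq, hconst, ← Finset.sum_mul, hw1, hw1']
  by_cases hpos : ∀ x, x ≠ 0 → 0 < B x x
  swap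
  · exact ⟨1, one_ne_zero, fun μ _ w hw _ hP => absurd
      (pos_of_isProbabilityMeasure_mixtureMeasure B hB hsymm w μ hw hP 0) hpos⟩
  obtain ⟨f, hf0, hf⟩ := exists_mvPolynomial_generic (n := n) B hd (by omega) hsymm hpos
  refine ⟨f, hf0, fun μ hμ w hw _ hP w' μ' hw' _ _ hlaw => ?_⟩
  obtain ⟨hinj, hrec⟩ := hf μ hμ
  have hsum := sum_filter_eq_of_sum_mul_exp_eq _ _ _ _ (1 / 4) (by norm_num)
    (sum_mul_exp_eq_of_deltaLaw_eq B hB hsymm hpos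
      (lintegral_formGaussian_lt_top B hB w μ hw hP 0) w w' μ μ' hw hw' hlaw)
  obtain ⟨σ, hσ, hσD⟩ := exists_perm_of_sum_filter_eq (formSqDist B μ) (formSqDist B μ')
    (fun e => formSqDist_of_isDiag B μ) (fun e => formSqDist_of_isDiag B μ') hinj w w' hw hsum
  obtain ⟨τ, hτ⟩ := hrec σ hσ μ' hσD
  have hD : ∀ p q, formSqDist B μ' s(p, q) = formSqDist B μ s(τ p, τ q) := by
    intro p q
    rcases eq_or_ne p q with rfl | hpq
    · simp
    · rw [hσD, Function.comp_apply, hτ p q hpq]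
  have hweights : w' = w ∘ τ := by
    refine weights_eq_of_mul_eq (by omega) _ _ hw' (fun i => hw _) fun p q hpq => ?_
    have hτpq : τ p ≠ τ q := fun h => hpq (τ.injective h)
    -- At this value each side has just one unordered pair, counted in both orders, so the weight
    -- products agree.
    have h1 := hsum (formSqDist B μ s(τ p, τ q))
    have h2 : ∀ z : Fin (n + 1) × Fin (n + 1),
        formSqDist B μ s(z.1, z.2) = formSqDist B μ s(τ p, τ q) ↔ s(z.1, z.2) = s(τ p, τ q) :=
      fun z => ⟨hinj _ _ (by rwa [Sym2.mk_isDiag_iff]), fun h => by rw [h]⟩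
    have h3 : ∀ z : Fin (n + 1) × Fin (n + 1),
        formSqDist B μ' s(z.1, z.2) = formSqDist B μ s(τ p, τ q) ↔ s(z.1, z.2) = s(p, q) := by
      intro z
      rw [hD, h2 (τ z.1, τ z.2)]
      simp only [Sym2.eq_iff, τ.injective.eq_iff]
    simp only [h2, h3] at h1
    rw [sum_filter_mk_eq w' hpq, sum_filter_mk_eq w hτpq] at h1
    exact mul_left_cancel₀ two_ne_zero h1
  obtain ⟨g, v, hg, hgv⟩ := exists_isOrthogonal_of_formSqDist_eq B hsymm hpos μ' (μ ∘ τ)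
    (funext fun e => by
      induction e using Sym2.inductionOn with
      | _ p q => exact hD p q)
  exact ⟨g, v, hg, mixtureDensity_comp_isOrthogonal B w w' μ μ' τ g v hg hgv hweights⟩
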